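/- For a real normed space $X$ and a closed subspace $Y\subset X$, a projection of $X$ onto $Y$ is a bounded linear operator $P:X\to Y$ with $P|_Y=\mathrm{id}_Y$, and the relative projection constant is $$\lambda(Y,X)=\inf\{\|P\| : P \text{ is a projection of } X \text{ onto } Y\}.$$ For every integer $n\ge 4$ there exists an $n$-dimensional real normed space $X$ such that $$\lambda(Y,X) > 1+\left(2(n+3)^2\right)^{-100(n+3)^2}$$ for every $(n-1)$-dimensional subspace $Y$ of $X$. Explicitly, one may take $X=(\mathbb{R}^n,\|\cdot\|)$ with $$\|x\|=\Big(\sum_{i=1}^{n+2}|f_i(x)|^{2p}\Big)^{\frac1{2p}},\qquad p=\Big\lceil \frac{n+2}{2}\Big\rceil,$$ where $f_i(x)=x_i$ for $1\le i\le n$, $f_{n+1}(x)=x_1+x_2+\dots+x_n$ and $f_{n+2}(x)=\frac1n(x_1+2x_2+\dots+nx_n)$. -/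

import Mathlib

/-- The bounded linear projections of `X` onto its subspace `Y`: the bounded linear operators
`P : X → Y` whose restriction to `Y` is the identity. -/
def projections {X : Type*} [NormedAddCommGroup X] [NormedSpace ℝ X] (Y : Submodule ℝ X) :
    Set (X →L[ℝ] Y) :=
  {P | ∀ y : Y, P y = y}

/-- In a finite-dimensional space every subspace is the range of a bounded projection, so the
infimum in `relProjConst` is then taken over a nonempty set (bounded below by `0`). -/
theorem projections_nonempty {X : Type*} [NormedAddCommGroup X] [NormedSpace ℝ X]
    [FiniteDimensional ℝ X] (Y : Submodule ℝ X) : (projections Y).Nonempty :=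
  Submodule.ClosedComplemented.of_finiteDimensional Y

/-- The relative projection constant `λ(Y, X)`: the infimum of the operator norms of all bounded
projections of `X` onto `Y`. -/
noncomputable def relProjConst {X : Type*} [NormedAddCommGroup X] [NormedSpace ℝ X]
    (Y : Submodule ℝ X) : ℝ :=
  sInf ((fun P : X →L[ℝ] Y => ‖P‖) '' projections Y)

/-- The `n + 2` linear functionals on `ℝⁿ`: the `n` coordinates, then `x₁ + ⋯ + xₙ`, then
`(x₁ + 2 x₂ + ⋯ + n xₙ) / n`. (Indices start at `0`, so the coordinate `x j` carries the
weight `j + 1`.) -/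
noncomputable def functionals (n : ℕ) : Fin (n + 2) → ((Fin n → ℝ) →ₗ[ℝ] ℝ) :=
  Fin.append (fun i : Fin n => LinearMap.proj i)
    ![∑ j : Fin n, LinearMap.proj j,
      (n : ℝ)⁻¹ • ∑ j : Fin n, ((j : ℝ) + 1) • LinearMap.proj j]

/-- The exponent `p = ⌈(n + 2) / 2⌉`. -/
noncomputable def halfExponent (n : ℕ) : ℕ := ⌈((n : ℝ) + 2) / 2⌉₊

/-- The norm `(∑ |fᵢ(x)|^(2p))^(1/(2p))` on `ℝⁿ`, where `f₁, …, fₙ₊₂` are the above functionals and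
`p = ⌈(n + 2) / 2⌉`. -/
noncomputable def explicitNorm (n : ℕ) (x : Fin n → ℝ) : ℝ :=
  (∑ i : Fin (n + 2), |functionals n i x| ^ (2 * halfExponent n)) ^
    (1 / (2 * (halfExponent n : ℝ)))

/-!
Let `P` be a projection onto a hyperplane `ker g` and let `P v = 0`, `‖v‖ = 1`. If some `y ∈ ker g`
has `∑ fᵢ(v) fᵢ(y)^(2p-1) ≠ 0`, a small step from `y` along `v` decreases the norm, whereas `P` maps
the result back to `y`; hence `‖P‖ > 1`, and quantitative bounds on `y` and on the sum give the
explicit constant.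

To find `y`, choose `i` with `fᵢ(v)` not small and polarize `∑ fⱼ(v) fⱼ^(2p-1)` along `2p - 1`
vectors `w ∈ ker g` with `fᵢ(w) = 1`. Since `2p - 1` is at least the number of indices `j ≠ i`, each
`fⱼ` can be made to vanish at one of them, and only the term of index `i` survives. The vector
needed for `j` exists with a good bound unless `g` is near the span of `fᵢ` and `fⱼ`. By general
position there is room to choose `i` so that this never happens, except when `g` is itself nearly
proportional to some `fₖ`; then `fₖ` is uniformly small on `ker g`, and so is its term.
-/

/-! ### Polarization -/

theorem sum_neg_one_pow_card_mul_sum_compl_pow {τ R : Type*} [Fintype τ] [DecidableEq τ]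
    [CommRing R] (a : τ → R) :
    ∑ S : Finset τ, (-1) ^ S.card * (∑ t ∈ Sᶜ, a t) ^ Fintype.card τ =
      (Fintype.card τ).factorial * ∏ t, a t := by
  let avoiding : τ → Finset (τ → τ) := fun t => {p | ∀ s, p s ≠ t}
  have expand (S : Finset τ) : (∑ t ∈ Sᶜ, a t) ^ Fintype.card τ =
      ∑ p ∈ S.inf avoiding, ∏ s, a (p s) := by
    rw [← Finset.card_univ, ← Finset.prod_const, Finset.prod_univ_sum]
    refine Finset.sum_congr ?_ fun _ _ => rfl
    ext p
    simp only [Fintype.mem_piFinset, Finset.mem_compl, Finset.mem_inf, avoiding, Finset.mem_filter,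
      Finset.mem_univ, true_and]
    grind
  have surjective : ∑ p ∈ Finset.univ.inf fun t => (avoiding t)ᶜ, ∏ s, a (p s) =
      ∑ σ : Equiv.Perm τ, ∏ s, a (σ s) := by
    symm
    refine Finset.sum_bij (fun σ _ => σ) ?_ (fun σ _ π _ h => DFunLike.coe_injective h) ?_
      fun _ _ => rfl
    · intro σ _
      simpa [avoiding, Finset.mem_inf, Function.Surjective] using σ.surjective
    · intro p hp
      have hp : Function.Surjective p := by
        simpa [avoiding, Finset.mem_inf, Function.Surjective] using hp
      exact ⟨Equiv.ofBijective p (Finite.injective_iff_surjective.2 hp |>.bijective_of_finite),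
        Finset.mem_univ _, rfl⟩
  have := Finset.inclusion_exclusion_sum_inf_compl Finset.univ avoiding fun p => ∏ s, a (p s)
  simp_rw [surjective, Equiv.prod_comp, ← expand] at this
  simpa [Fintype.card_perm, zsmul_eq_mul] using this.symm

theorem exists_factorial_mul_abs_sum_mul_prod_le {ι τ X : Type*} [Fintype ι] [Fintype τ]
    [AddCommGroup X] [Module ℝ X] (c : ι → ℝ) (f : ι → X →ₗ[ℝ] ℝ) (w : τ → X) :
    ∃ S : Finset τ, (Fintype.card τ).factorial * |∑ i, c i * ∏ t, f i (w t)| ≤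
      2 ^ Fintype.card τ * |∑ i, c i * f i (∑ t ∈ S, w t) ^ Fintype.card τ| := by
  classical
  set q := Fintype.card τ
  let Q : X → ℝ := fun x => ∑ i, c i * f i x ^ q
  have polarization : q.factorial * ∑ i, c i * ∏ t, f i (w t) =
      ∑ S : Finset τ, (-1) ^ S.card * Q (∑ t ∈ Sᶜ, w t) := by
    simp only [Q, Finset.mul_sum]
    rw [Finset.sum_comm]
    refine Finset.sum_congr rfl fun i _ => ?_
    rw [mul_left_comm, ← sum_neg_one_pow_card_mul_sum_compl_pow, Finset.mul_sum]
    simp only [map_sum, mul_left_comm, q]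
  obtain ⟨S, -, hS⟩ := Finset.exists_max_image (Finset.univ : Finset (Finset τ))
    (fun S => |Q (∑ t ∈ Sᶜ, w t)|) Finset.univ_nonempty
  refine ⟨Sᶜ, ?_⟩
  calc q.factorial * |∑ i, c i * ∏ t, f i (w t)|
      = |∑ S : Finset τ, (-1) ^ S.card * Q (∑ t ∈ Sᶜ, w t)| := by
        rw [← polarization, abs_mul, Nat.abs_cast]
    _ ≤ ∑ S : Finset τ, |Q (∑ t ∈ Sᶜ, w t)| := by
        simpa [abs_mul] using Finset.abs_sum_le_sum_abs
          (fun S : Finset τ => (-1) ^ S.card * Q (∑ t ∈ Sᶜ, w t)) Finset.univ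
    _ ≤ 2 ^ q * |Q (∑ t ∈ Sᶜ, w t)| := by
        simpa [q] using Finset.sum_le_card_nsmul Finset.univ _ _ hS

/-! ### Real inequalities -/

theorem abs_add_pow_sub_le (a d : ℝ) (hd : |d| ≤ 1) (m : ℕ) :
    |(a + d) ^ (m + 1) - a ^ (m + 1) - (m + 1) * a ^ m * d| ≤
      d ^ 2 * ((|a| + 1) ^ (m + 1) - |a| ^ (m + 1) - (m + 1) * |a| ^ m) := by
  induction m with
  | zero => simp
  | succ m ih =>
    have remainder_succ : (a + d) ^ (m + 1 + 1) - a ^ (m + 1 + 1) -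
        ((m + 1 : ℕ) + 1) * a ^ (m + 1) * d =
        (a + d) * ((a + d) ^ (m + 1) - a ^ (m + 1) - (m + 1) * a ^ m * d) +
          (m + 1) * a ^ m * d ^ 2 := by
      push_cast; ring
    have bound_succ : d ^ 2 * ((|a| + 1) ^ (m + 1 + 1) - |a| ^ (m + 1 + 1) -
        ((m + 1 : ℕ) + 1) * |a| ^ (m + 1)) =
        (|a| + 1) * (d ^ 2 * ((|a| + 1) ^ (m + 1) - |a| ^ (m + 1) - (m + 1) * |a| ^ m)) +
          (m + 1) * |a| ^ m * d ^ 2 := by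
      push_cast; ring
    rw [remainder_succ, bound_succ]
    refine (abs_add_le _ _).trans (add_le_add ?_ ?_)
    · rw [abs_mul]
      gcongr
      exact (abs_add_le a d).trans (by gcongr)
    · rw [abs_mul, abs_mul, abs_pow, abs_of_nonneg (sq_nonneg d),
        abs_of_nonneg (by positivity : (0 : ℝ) ≤ m + 1)]

theorem add_pow_le_taylor {a d : ℝ} (hd : |d| ≤ 1) (m : ℕ) :
    (a + d) ^ (m + 1) ≤ a ^ (m + 1) + (m + 1) * a ^ m * d + d ^ 2 * (|a| + 1) ^ (m + 1) := by
  have h := (abs_le.1 (abs_add_pow_sub_le a d hd m)).2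
  have : d ^ 2 * ((|a| + 1) ^ (m + 1) - |a| ^ (m + 1) - (m + 1) * |a| ^ m) ≤
      d ^ 2 * (|a| + 1) ^ (m + 1) := by
    gcongr
    have : 0 ≤ |a| ^ (m + 1) := by positivity
    have : 0 ≤ (m + 1) * |a| ^ m := by positivity
    linarith
  linarith

theorem pow_sub_pow_le_of_le_one_add_mul {a b ε : ℝ} (ha : 0 ≤ a) (hb : 0 ≤ b) (hε : ε ≤ 1)
    (hab : a ≤ (1 + ε) * b) (q : ℕ) : a ^ q - b ^ q ≤ q * ε * a ^ q := by
  have hle : (1 - ε) * a ≤ b := by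
    calc (1 - ε) * a ≤ (1 - ε) * ((1 + ε) * b) := by gcongr
      _ ≤ b := by nlinarith [mul_nonneg (sq_nonneg ε) hb]
  have bernoulli : 1 - q * ε ≤ (1 - ε) ^ q := by
    simpa [sub_eq_add_neg] using one_add_mul_le_pow (a := -ε) (by linarith) q
  have : (1 - q * ε) * a ^ q ≤ b ^ q := by
    calc (1 - q * ε) * a ^ q ≤ (1 - ε) ^ q * a ^ q := by gcongr
      _ = ((1 - ε) * a) ^ q := (mul_pow _ _ _).symm
      _ ≤ b ^ q := pow_le_pow_left₀ (mul_nonneg (by linarith) ha) hle q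
  linarith

theorem abs_le_of_pow_eq_sum {ι : Type*} [Fintype ι] {q : ℕ} (hq : Even q) (hq0 : q ≠ 0) {r : ℝ}
    (hr : 0 ≤ r) {a : ι → ℝ} (h : r ^ q = ∑ i, a i ^ q) (i : ι) : |a i| ≤ r := by
  refine le_of_pow_le_pow_left₀ hq0 hr ?_
  rw [hq.pow_abs, h]
  exact Finset.single_le_sum (f := fun i => a i ^ q) (fun i _ => hq.pow_nonneg _)
    (Finset.mem_univ i)

theorem le_sum_abs_of_pow_eq_sum {ι : Type*} [Fintype ι] {q : ℕ} (hq : Even q) (hq0 : q ≠ 0)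
    {r : ℝ} {a : ι → ℝ} (h : r ^ q = ∑ i, a i ^ q) : r ≤ ∑ i, |a i| := by
  have sum_nonneg : 0 ≤ ∑ i, |a i| := Finset.sum_nonneg fun _ _ => abs_nonneg _
  refine le_of_pow_le_pow_left₀ hq0 sum_nonneg ?_
  obtain ⟨p, rfl⟩ := Nat.exists_eq_succ_of_ne_zero hq0
  calc r ^ (p + 1) = ∑ i, |a i| * |a i| ^ p := by
        rw [h]
        exact Finset.sum_congr rfl fun i _ => by rw [← pow_succ', hq.pow_abs]
    _ ≤ ∑ i, |a i| * (∑ j, |a j|) ^ p := by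
        gcongr with i
        exact Finset.single_le_sum (f := fun i => |a i|) (fun _ _ => abs_nonneg _)
          (Finset.mem_univ i)
    _ = (∑ i, |a i|) ^ (p + 1) := by rw [← Finset.sum_mul, pow_succ']

theorem exists_abs_eq_and_mul_eq_neg (G : ℝ) {τ : ℝ} (hτ : 0 ≤ τ) :
    ∃ t, |t| = τ ∧ t * G = -(τ * |G|) := by
  rcases abs_cases G with ⟨hG, -⟩ | ⟨hG, -⟩
  · exact ⟨-τ, by rw [abs_neg, abs_of_nonneg hτ], by rw [hG]; ring⟩
  · exact ⟨τ, abs_of_nonneg hτ, by rw [hG]; ring⟩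

theorem sum_apply_add_smul_pow_le {ι X : Type*} [Fintype ι] [SeminormedAddCommGroup X]
    [NormedSpace ℝ X] {f : ι → X →ₗ[ℝ] ℝ} (hf : ∀ i x, |f i x| ≤ ‖x‖) {v : X} (hv : ‖v‖ ≤ 1)
    (y : X) {t : ℝ} (ht : |t| ≤ 1) (m : ℕ) :
    ∑ i, f i (y + t • v) ^ (m + 1) ≤ ∑ i, f i y ^ (m + 1) +
      (m + 1) * t * ∑ i, f i v * f i y ^ m + Fintype.card ι * t ^ 2 * (‖y‖ + 1) ^ (m + 1) := by
  have term_le : ∀ i, f i (y + t • v) ^ (m + 1) ≤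
      f i y ^ (m + 1) + (m + 1) * t * (f i v * f i y ^ m) + t ^ 2 * (‖y‖ + 1) ^ (m + 1) := by
    intro i
    have hiv : |f i v| ≤ 1 := (hf i v).trans hv
    have hd : |t * f i v| ≤ 1 := by
      rw [abs_mul]
      exact mul_le_one₀ ht (abs_nonneg _) hiv
    calc f i (y + t • v) ^ (m + 1) = (f i y + t * f i v) ^ (m + 1) := by
          rw [map_add, map_smul, smul_eq_mul]
      _ ≤ f i y ^ (m + 1) + (m + 1) * f i y ^ m * (t * f i v) +
          (t * f i v) ^ 2 * (|f i y| + 1) ^ (m + 1) := add_pow_le_taylor hd m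
      _ ≤ f i y ^ (m + 1) + (m + 1) * f i y ^ m * (t * f i v) +
          t ^ 2 * (‖y‖ + 1) ^ (m + 1) := by
          have : (t * f i v) ^ 2 ≤ t ^ 2 := by
            rw [mul_pow]
            exact mul_le_of_le_one_right (sq_nonneg t) ((sq_le_one_iff_abs_le_one _).2 hiv)
          gcongr
          exact hf i y
      _ = _ := by ring
  calc ∑ i, f i (y + t • v) ^ (m + 1)
      ≤ ∑ i, (f i y ^ (m + 1) + (m + 1) * t * (f i v * f i y ^ m) +
          t ^ 2 * (‖y‖ + 1) ^ (m + 1)) := Finset.sum_le_sum fun i _ => term_le i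
    _ = _ := by
      rw [Finset.sum_add_distrib, Finset.sum_add_distrib, ← Finset.mul_sum, Finset.sum_const,
        Finset.card_univ, nsmul_eq_mul, mul_assoc (Fintype.card ι : ℝ)]

/-! ### Hyperplanes and projections -/

section Projections

variable {X : Type*} [NormedAddCommGroup X] [NormedSpace ℝ X]

theorem exists_norm_eq_one_ker_eq [FiniteDimensional ℝ X] {Y : Submodule ℝ X}
    (hY : Module.finrank ℝ Y + 1 = Module.finrank ℝ X) :
    ∃ g : StrongDual ℝ X, ‖g‖ = 1 ∧ LinearMap.ker (g : X →ₗ[ℝ] ℝ) = Y := by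
  have hlt : Y < ⊤ := Submodule.lt_top_of_finrank_lt_finrank (by omega)
  obtain ⟨φ, hφ, hYφ⟩ := Submodule.exists_le_ker_of_lt_top Y hlt
  have ker_eq : LinearMap.ker φ = Y := by
    refine (Submodule.eq_of_le_of_finrank_eq hYφ ?_).symm
    have := Module.Dual.finrank_ker_add_one_of_ne_zero (f := φ) hφ
    omega
  have hφ0 : ‖LinearMap.toContinuousLinearMap φ‖ ≠ 0 := by simpa using hφ
  refine ⟨‖LinearMap.toContinuousLinearMap φ‖⁻¹ • LinearMap.toContinuousLinearMap φ, ?_, ?_⟩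
  · rw [norm_smul, norm_inv, norm_norm, inv_mul_cancel₀ hφ0]
  · rw [← ker_eq]
    exact LinearMap.ker_smul φ _ (inv_ne_zero hφ0)

theorem exists_norm_eq_one_map_eq_zero {Z : Type*} [NormedAddCommGroup Z] [NormedSpace ℝ Z]
    [FiniteDimensional ℝ X] [FiniteDimensional ℝ Z] (P : X →L[ℝ] Z)
    (h : Module.finrank ℝ Z < Module.finrank ℝ X) : ∃ v, ‖v‖ = 1 ∧ P v = 0 := by
  obtain ⟨u, hu, hu0⟩ := (Submodule.ne_bot_iff _).1
    (LinearMap.ker_ne_bot_of_finrank_lt (f := (P : X →ₗ[ℝ] Z)) h)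
  refine ⟨‖u‖⁻¹ • u, norm_smul_inv_norm hu0, ?_⟩
  rw [map_smul, show P u = 0 from hu, smul_zero]

theorem norm_le_opNorm_mul_norm_add_smul {Y : Submodule ℝ X} {P : X →L[ℝ] Y}
    (hP : P ∈ projections Y) {v y : X} (hv : P v = 0) (hy : y ∈ Y) (t : ℝ) :
    ‖y‖ ≤ ‖P‖ * ‖y + t • v‖ := by
  have : P (y + t • v) = ⟨y, hy⟩ := by
    rw [map_add, map_smul, hv, smul_zero, add_zero]
    exact hP ⟨y, hy⟩
  simpa [this] using P.le_opNorm (y + t • v)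

end Projections

/-! ### Forms in general position -/

/-- Quantitative general position for at least six forms of norm at most `1` on a normed space:
whichever two forms `f a`, `f b` are discarded, the others are a basis of the dual space, the
vectors of whose dual basis have norm at most `M / card ι`. -/
structure GeneralPosition {ι X : Type*} [Fintype ι] [NormedAddCommGroup X] [NormedSpace ℝ X]
    (f : ι → X →ₗ[ℝ] ℝ) (M : ℝ) : Prop where
  six_le_card : 6 ≤ Fintype.card ι
  abs_le : ∀ i x, |f i x| ≤ ‖x‖
  exists_dual : ∀ i a b, i ≠ a → i ≠ b → a ≠ b → ∃ e, f i e = 1 ∧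
    (∀ j, j ≠ i → j ≠ a → j ≠ b → f j e = 0) ∧ Fintype.card ι * ‖e‖ ≤ M
  eq_zero : ∀ a b x, a ≠ b → (∀ j, j ≠ a → j ≠ b → f j x = 0) → x = 0

/-- The functional `g` is at distance at most `β` from the span of `f₁` and `f₂`: by Hahn–Banach it
is enough to bound `g` on the common kernel. With `f₁ = f₂` this is closeness to a line. -/
def NearSpan {X : Type*} [NormedAddCommGroup X] [NormedSpace ℝ X] (g : StrongDual ℝ X) (β : ℝ)
    (f₁ f₂ : X →ₗ[ℝ] ℝ) : Prop :=
  ∀ u, f₁ u = 0 → f₂ u = 0 → |g u| ≤ β * ‖u‖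

/-- The vectors of `ker g`, normalized by `φ = 1` and of norm at most `B`. The polarization identity
is applied to them: its evaluation points then lie in `ker g`, and `φ` contributes a factor `1`. -/
def directions {X : Type*} [NormedAddCommGroup X] [NormedSpace ℝ X] (g : StrongDual ℝ X)
    (φ : X →ₗ[ℝ] ℝ) (B : ℝ) : Set X :=
  {w | g w = 0 ∧ φ w = 1 ∧ ‖w‖ ≤ B}

namespace NearSpan

variable {X : Type*} [NormedAddCommGroup X] [NormedSpace ℝ X] {g : StrongDual ℝ X} {β : ℝ}
  {f₁ f₂ f₃ f₄ : X →ₗ[ℝ] ℝ}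

theorem symm (h : NearSpan g β f₁ f₂) : NearSpan g β f₂ f₁ :=
  fun u h₂ h₁ => h u h₁ h₂

theorem abs_apply_le (h₁₂ : NearSpan g β f₁ f₂) (h₃₄ : NearSpan g β f₃ f₄) (hβ : 0 ≤ β) {x z : X}
    (h₁ : f₁ z = f₁ x) (h₂ : f₂ z = f₂ x) (h₃ : f₃ z = 0) (h₄ : f₄ z = 0) :
    |g x| ≤ β * (‖x‖ + 2 * ‖z‖) := by
  calc |g x| ≤ |g (x - z)| + |g z| := by simpa using abs_add_le (g (x - z)) (g z)
    _ ≤ β * ‖x - z‖ + β * ‖z‖ :=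
      add_le_add (h₁₂ _ (by simp [h₁]) (by simp [h₂])) (h₃₄ _ h₃ h₄)
    _ ≤ β * (‖x‖ + ‖z‖) + β * ‖z‖ := by
      gcongr
      exact norm_sub_le x z
    _ = β * (‖x‖ + 2 * ‖z‖) := by ring

end NearSpan

namespace GeneralPosition

variable {ι X : Type*} [Fintype ι] [NormedAddCommGroup X] [NormedSpace ℝ X]
  {f : ι → X →ₗ[ℝ] ℝ} {M : ℝ} {g : StrongDual ℝ X}

theorem exists_notMem (hf : GeneralPosition f M) {s : Finset ι} (hs : s.card ≤ 5) :
    ∃ a, a ∉ s := by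
  by_contra! h
  have := hf.six_le_card
  rw [← Finset.card_univ, ← Finset.eq_univ_of_forall h] at this
  omega

theorem exists_dual_of_ne (hf : GeneralPosition f M) {i j k l : ι} (hj : j ≠ i) (hk : k ≠ i)
    (hl : l ≠ i) : ∃ e, f i e = 1 ∧ f j e = 0 ∧ f k e = 0 ∧ f l e = 0 ∧ 6 * ‖e‖ ≤ M := by
  classical
  obtain ⟨a, ha⟩ := hf.exists_notMem (s := {i, j, k, l}) (Finset.card_le_four.trans (by simp))
  obtain ⟨b, hb⟩ := hf.exists_notMem (s := {i, j, k, l, a}) Finset.card_le_five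
  simp only [Finset.mem_insert, Finset.mem_singleton, not_or] at ha hb
  obtain ⟨e, hie, hje, he⟩ := hf.exists_dual i a b (by tauto) (by tauto) (by tauto)
  refine ⟨e, hie, hje j hj (by tauto) (by tauto), hje k hk (by tauto) (by tauto),
    hje l hl (by tauto) (by tauto), le_trans ?_ he⟩
  gcongr
  exact_mod_cast hf.six_le_card

theorem nontrivial (hf : GeneralPosition f M) : Nontrivial ι :=
  Fintype.one_lt_card_iff_nontrivial.1 (by linarith [hf.six_le_card])

theorem six_le (hf : GeneralPosition f M) : 6 ≤ M := by
  have := hf.nontrivial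
  obtain ⟨i, j, hij⟩ := exists_pair_ne ι
  obtain ⟨e, hie, -, -, -, he⟩ := hf.exists_dual_of_ne hij.symm hij.symm hij.symm
  have : |f i e| ≤ ‖e‖ := hf.abs_le i e
  rw [hie, abs_one] at this
  linarith

theorem finiteDimensional (hf : GeneralPosition f M) : FiniteDimensional ℝ X := by
  have := hf.nontrivial
  obtain ⟨a, b, hab⟩ := exists_pair_ne ι
  refine Module.Finite.of_injective (LinearMap.pi f) ((injective_iff_map_eq_zero _).2 ?_)
  exact fun x hx => hf.eq_zero a b x hab fun j _ _ => congrFun hx j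

theorem exists_norm_le_mul_abs (hf : GeneralPosition f M) {a b : ι} (hab : a ≠ b) (x : X) :
    ∃ k, k ≠ a ∧ k ≠ b ∧ ‖x‖ ≤ M * |f k x| := by
  classical
  choose! e hie hje he using fun i (hi : i ≠ a ∧ i ≠ b) => hf.exists_dual i a b hi.1 hi.2 hab
  set s : Finset ι := {a, b}ᶜ
  have mem_s : ∀ i, i ∈ s ↔ i ≠ a ∧ i ≠ b := by simp [s]
  have expansion : x = ∑ i ∈ s, f i x • e i := by
    refine sub_eq_zero.1 (hf.eq_zero a b _ hab fun j hja hjb => ?_)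
    have hj : j ∈ s := (mem_s j).2 ⟨hja, hjb⟩
    rw [map_sub, map_sum, Finset.sum_eq_single_of_mem j hj, map_smul, hie j ⟨hja, hjb⟩,
      smul_eq_mul, mul_one, sub_self]
    intro i hi hij
    have hi := (mem_s i).1 hi
    rw [map_smul, hje i hi j hij.symm hja hjb, smul_zero]
  obtain ⟨c, hc⟩ := hf.exists_notMem (s := {a, b}) (Finset.card_le_two.trans (by simp))
  obtain ⟨k, hk, hmax⟩ := s.exists_max_image (fun i => |f i x|) ⟨c, by simpa [s] using hc⟩
  refine ⟨k, ((mem_s k).1 hk).1, ((mem_s k).1 hk).2, ?_⟩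
  have card_pos : (0 : ℝ) < Fintype.card ι := by
    exact_mod_cast (by linarith [hf.six_le_card] : 0 < Fintype.card ι)
  calc ‖x‖ = ‖∑ i ∈ s, f i x • e i‖ := congrArg _ expansion
    _ ≤ ∑ i ∈ s, ‖f i x • e i‖ := norm_sum_le _ _
    _ ≤ ∑ _i ∈ s, |f k x| * (M / Fintype.card ι) := by
      refine Finset.sum_le_sum fun i hi => ?_
      rw [norm_smul, Real.norm_eq_abs]
      exact mul_le_mul (hmax i hi) ((le_div_iff₀' card_pos).2 (he i ((mem_s i).1 hi)))
        (norm_nonneg _) (abs_nonneg _)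
    _ ≤ ∑ _i, |f k x| * (M / Fintype.card ι) := by
      refine Finset.sum_le_sum_of_subset_of_nonneg s.subset_univ fun _ _ _ => ?_
      have := hf.six_le
      positivity
    _ = M * |f k x| := by
      rw [Finset.sum_const, Finset.card_univ, nsmul_eq_mul]
      field_simp

theorem nearSpan_self_of_nearSpan_of_nearSpan (hf : GeneralPosition f M) {β : ℝ} (hβ : 0 ≤ β)
    {i j k : ι} (hij : i ≠ j) (hjk : j ≠ k) (hgj : NearSpan g β (f i) (f j))
    (hgk : NearSpan g β (f i) (f k)) : NearSpan g (β * M) (f i) (f i) := by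
  intro x hx _
  obtain ⟨e, hje, hie, hke, -, he⟩ := hf.exists_dual_of_ne hij hjk.symm hjk.symm
  have norm_le : ‖f j x • e‖ ≤ ‖x‖ * ‖e‖ := by
    rw [norm_smul]
    gcongr
    exact hf.abs_le j x
  calc |g x| ≤ β * (‖x‖ + 2 * ‖f j x • e‖) :=
        hgj.abs_apply_le hgk hβ (by simp [hx, hie]) (by simp [hje]) (by simp [hie]) (by simp [hke])
    _ ≤ β * (M * ‖x‖) := by
      gcongr
      nlinarith [norm_nonneg x, hf.six_le]
    _ = β * M * ‖x‖ := by ring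

theorem opNorm_le_of_nearSpan_of_nearSpan (hf : GeneralPosition f M) {β : ℝ} (hβ : 0 ≤ β)
    {i j k l : ι} (hij : i ≠ j) (hik : i ≠ k) (hil : i ≠ l) (hjk : j ≠ k) (hjl : j ≠ l)
    (hgij : NearSpan g β (f i) (f j)) (hgkl : NearSpan g β (f k) (f l)) : ‖g‖ ≤ β * M := by
  have := hf.six_le
  refine g.opNorm_le_bound (by positivity) fun x => ?_
  obtain ⟨e, hie, hje, hke, hle, he⟩ := hf.exists_dual_of_ne hij.symm hik.symm hil.symm
  obtain ⟨e', hje', hie', hke', hle', he'⟩ := hf.exists_dual_of_ne hij hjk.symm hjl.symm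
  have norm_le : ‖f i x • e + f j x • e'‖ ≤ ‖x‖ * ‖e‖ + ‖x‖ * ‖e'‖ := by
    refine (norm_add_le _ _).trans ?_
    rw [norm_smul, norm_smul]
    gcongr
    exacts [hf.abs_le i x, hf.abs_le j x]
  calc ‖g x‖ ≤ β * (‖x‖ + 2 * ‖f i x • e + f j x • e'‖) :=
        hgij.abs_apply_le hgkl hβ (by simp [hie, hie']) (by simp [hje, hje'])
          (by simp [hke, hke']) (by simp [hle, hle'])
    _ ≤ β * (M * ‖x‖) := by
      gcongr
      nlinarith [norm_nonneg x]
    _ = β * M * ‖x‖ := by ring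

theorem exists_pair_forall_not_nearSpan (hf : GeneralPosition f M) {β : ℝ} (hβ : 0 ≤ β)
    (hg : β * M < ‖g‖) (hself : ∀ k, ¬ NearSpan g (β * M) (f k) (f k)) :
    ∃ a b, a ≠ b ∧ ∀ i j, i ≠ j → i ≠ a → i ≠ b → ¬ NearSpan g β (f i) (f j) := by
  by_cases h : ∃ a b, a ≠ b ∧ NearSpan g β (f a) (f b)
  · obtain ⟨a, b, hab, hgab⟩ := h
    refine ⟨a, b, hab, fun i j _ hia hib hgij => ?_⟩
    rcases eq_or_ne j a with rfl | hja
    · exact hself j <| hf.nearSpan_self_of_nearSpan_of_nearSpan hβ hab hib.symm hgab hgij.symm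
    rcases eq_or_ne j b with rfl | hjb
    · exact hself j <| hf.nearSpan_self_of_nearSpan_of_nearSpan hβ hab.symm hia.symm
        hgab.symm hgij.symm
    · exact hg.not_ge <| hf.opNorm_le_of_nearSpan_of_nearSpan hβ hab hia.symm hja.symm hib.symm
        hjb.symm hgab hgij
  · have := hf.nontrivial
    obtain ⟨a, b, hab⟩ := exists_pair_ne ι
    exact ⟨a, b, hab, fun i j hij _ _ hgij => h ⟨i, j, hij, hgij⟩⟩

theorem exists_mem_directions (hf : GeneralPosition f M) (hg : ‖g‖ ≤ 1) {i j : ι} (hij : i ≠ j)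
    {u : X} (hi : f i u = 0) (hj : f j u = 0) (hgu : g u ≠ 0) {C : ℝ} (hu : ‖u‖ ≤ C * |g u|) :
    ∃ w ∈ directions g (f i) (M * (1 + C)), f j w = 0 := by
  obtain ⟨e, hie, hje, -, -, he⟩ := hf.exists_dual_of_ne hij.symm hij.symm hij.symm
  have hC : 0 ≤ C := nonneg_of_mul_nonneg_left ((norm_nonneg u).trans hu) (abs_pos.2 hgu)
  refine ⟨e - (g e / g u) • u, ⟨by simp [hgu], by simp [hie, hi], ?_⟩, by simp [hje, hj]⟩
  calc ‖e - (g e / g u) • u‖ ≤ ‖e‖ + ‖e‖ * C := by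
        refine (norm_sub_le _ _).trans (add_le_add_right ?_ _)
        rw [norm_smul, norm_div, div_mul_eq_mul_div, mul_div_assoc]
        gcongr
        · exact g.le_of_opNorm_le_of_le hg le_rfl |>.trans_eq (one_mul _)
        · exact (div_le_iff₀ (norm_pos_iff.2 hgu)).2 hu
    _ = ‖e‖ * (1 + C) := by ring
    _ ≤ M * (1 + C) := by
      gcongr
      linarith [norm_nonneg e]

theorem abs_sub_mul_le_of_nearSpan (hf : GeneralPosition f M) {α : ℝ} (hα : 0 ≤ α) {k : ι}
    (hk : NearSpan g α (f k) (f k)) {e : X} (hke : f k e = 1) (he : 6 * ‖e‖ ≤ M) (x : X) :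
    |g x - f k x * g e| ≤ α * M * ‖x‖ := by
  have hker : f k (x - f k x • e) = 0 := by simp [hke]
  have norm_le : ‖x - f k x • e‖ ≤ M * ‖x‖ := by
    refine (norm_sub_le _ _).trans ?_
    rw [norm_smul]
    have := mul_le_mul_of_nonneg_right (hf.abs_le k x) (norm_nonneg e)
    nlinarith [hf.six_le, norm_nonneg x, Real.norm_eq_abs (f k x)]
  calc |g x - f k x * g e| = |g (x - f k x • e)| := by simp
    _ ≤ α * ‖x - f k x • e‖ := hk _ hker hker
    _ ≤ α * (M * ‖x‖) := by gcongr
    _ = α * M * ‖x‖ := by ring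

theorem half_le_abs_of_nearSpan (hf : GeneralPosition f M) (hg : ‖g‖ = 1) {α : ℝ} (hα : 0 ≤ α)
    (hαM : α * M ≤ 1 / 2) {k : ι} (hk : NearSpan g α (f k) (f k)) {e : X} (hke : f k e = 1)
    (he : 6 * ‖e‖ ≤ M) : 1 / 2 ≤ |g e| := by
  have : ‖g‖ ≤ |g e| + α * M := by
    have := hf.six_le
    refine g.opNorm_le_bound (by positivity) fun x => ?_
    calc ‖g x‖ ≤ |f k x * g e| + |g x - f k x * g e| := by
          simpa using abs_add_le (f k x * g e) (g x - f k x * g e)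
      _ ≤ ‖x‖ * |g e| + α * M * ‖x‖ := by
          rw [abs_mul]
          gcongr
          exacts [hf.abs_le k x, hf.abs_sub_mul_le_of_nearSpan hα hk hke he x]
      _ = (|g e| + α * M) * ‖x‖ := by ring
  linarith

theorem abs_le_of_nearSpan_of_apply_eq_zero (hf : GeneralPosition f M) (hg : ‖g‖ = 1) {α : ℝ}
    (hα : 0 ≤ α) (hαM : α * M ≤ 1 / 2) {k : ι} (hk : NearSpan g α (f k) (f k)) {x : X}
    (hx : g x = 0) : |f k x| ≤ 2 * α * M * ‖x‖ := by
  have := hf.nontrivial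
  obtain ⟨j, hj⟩ := exists_ne k
  obtain ⟨e, hke, -, -, -, he⟩ := hf.exists_dual_of_ne hj hj hj
  have hge := hf.half_le_abs_of_nearSpan hg hα hαM hk hke he
  have hx' := hf.abs_sub_mul_le_of_nearSpan hα hk hke he x
  rw [hx, zero_sub, abs_neg, abs_mul] at hx'
  have := mul_le_mul_of_nonneg_left hge (abs_nonneg (f k x))
  linarith

theorem exists_directions_of_nearSpan (hf : GeneralPosition f M) (hg : ‖g‖ = 1) {i k : ι}
    (hik : i ≠ k) (hk : NearSpan g (1 / M ^ 6) (f k) (f k)) {j : ι} (hj : j ≠ i) :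
    ∃ w ∈ directions g (f i) (M ^ 2),
      f j w = 0 ∨ ∀ w' ∈ directions g (f i) (M ^ 2), |f j w'| ≤ 1 / (2 * M ^ 2) := by
  classical
  have hM := hf.six_le
  have hα : 0 ≤ 1 / M ^ 6 := by positivity
  have hαM : 1 / M ^ 6 * M ≤ 1 / 2 := by
    calc 1 / M ^ 6 * M = 1 / M ^ 5 := by field_simp
      _ ≤ 1 / M ^ 1 := by gcongr <;> [linarith; norm_num]
      _ ≤ 1 / 2 := by gcongr; linarith
  have exists_kills : ∀ l, l ≠ i → l ≠ k → ∃ w ∈ directions g (f i) (M ^ 2), f l w = 0 := by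
    intro l hli hlk
    obtain ⟨e, hke, hie, hle, -, he⟩ := hf.exists_dual_of_ne hik hlk hlk
    have hge := hf.half_le_abs_of_nearSpan hg hα hαM hk hke he
    obtain ⟨w, ⟨hgw, hiw, hw⟩, hlw⟩ := hf.exists_mem_directions hg.le hli.symm hie hle
      (abs_pos.1 (by linarith)) (C := M / 3) (by nlinarith)
    exact ⟨w, ⟨hgw, hiw, hw.trans (by nlinarith)⟩, hlw⟩
  rcases eq_or_ne j k with rfl | hjk
  · obtain ⟨l, hl⟩ := hf.exists_notMem (s := {i, j}) (Finset.card_le_two.trans (by simp))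
    simp only [Finset.mem_insert, Finset.mem_singleton, not_or] at hl
    obtain ⟨w, hw, -⟩ := exists_kills l hl.1 hl.2
    refine ⟨w, hw, Or.inr fun w' hw' => ?_⟩
    calc |f j w'| ≤ 2 * (1 / M ^ 6) * M * ‖w'‖ :=
          hf.abs_le_of_nearSpan_of_apply_eq_zero hg hα hαM hk hw'.1
      _ ≤ 2 * (1 / M ^ 6) * M * M ^ 2 := by gcongr; exact hw'.2.2
      _ = 1 / (M ^ 2 * (M / 2)) := by field_simp
      _ ≤ 1 / (M ^ 2 * 2) := by gcongr; linarith
      _ = 1 / (2 * M ^ 2) := by rw [mul_comm]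
  · obtain ⟨w, hw, hjw⟩ := exists_kills j hj hjk
    exact ⟨w, hw, Or.inl hjw⟩

theorem exists_directions_of_not_nearSpan (hf : GeneralPosition f M) (hg : ‖g‖ ≤ 1) {i j : ι}
    (hij : i ≠ j) {β : ℝ} (hβ : 0 < β) (h : ¬ NearSpan g β (f i) (f j)) :
    ∃ w ∈ directions g (f i) (M * (1 + 1 / β)), f j w = 0 := by
  simp only [NearSpan, not_forall, not_le] at h
  obtain ⟨u, hiu, hju, hu⟩ := h
  refine hf.exists_mem_directions hg hij hiu hju ?_ ?_
  · exact abs_pos.1 ((by positivity : 0 ≤ β * ‖u‖).trans_lt hu)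
  · rw [one_div_mul_eq_div, le_div_iff₀ hβ, mul_comm]
    exact hu.le

theorem exists_directions (hf : GeneralPosition f M) (hg : ‖g‖ = 1) (v : X) :
    ∃ i, ‖v‖ ≤ M * |f i v| ∧ ∃ B ≤ M ^ 9, ∀ j, j ≠ i → ∃ w ∈ directions g (f i) B,
      f j w = 0 ∨ ∀ w' ∈ directions g (f i) B, |f j w'| ≤ 1 / (2 * M ^ 2) := by
  have hM := hf.six_le
  by_cases hself : ∃ k, NearSpan g (1 / M ^ 6) (f k) (f k)
  · obtain ⟨k, hk⟩ := hself
    have := hf.nontrivial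
    obtain ⟨b, hb⟩ := exists_ne k
    obtain ⟨i, hik, -, hiv⟩ := hf.exists_norm_le_mul_abs hb.symm v
    exact ⟨i, hiv, M ^ 2, pow_le_pow_right₀ (by linarith) (by norm_num),
      fun j hj => hf.exists_directions_of_nearSpan hg hik hk hj⟩
  · have hβM : 1 / M ^ 7 * M = 1 / M ^ 6 := by field_simp
    obtain ⟨a, b, hab, hpair⟩ := hf.exists_pair_forall_not_nearSpan (β := 1 / M ^ 7)
      (by positivity)
      (by rw [hβM, hg, div_lt_one (by positivity)]
          exact one_lt_pow₀ (by linarith) (by norm_num))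
      (by rw [hβM]; exact fun k hk => hself ⟨k, hk⟩)
    obtain ⟨i, hia, hib, hiv⟩ := hf.exists_norm_le_mul_abs hab v
    refine ⟨i, hiv, M * (1 + 1 / (1 / M ^ 7)), ?_, fun j hj => ?_⟩
    · have : 1 ≤ M ^ 7 := one_le_pow₀ (by linarith)
      calc M * (1 + 1 / (1 / M ^ 7)) = M * (1 + M ^ 7) := by rw [one_div_one_div]
        _ ≤ M * (M * M ^ 7) := by gcongr; nlinarith
        _ = M ^ 9 := by ring
    · obtain ⟨w, hw, hjw⟩ := hf.exists_directions_of_not_nearSpan hg.le hj.symm (by positivity)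
        (hpair i j hj.symm hia hib)
      exact ⟨w, hw, Or.inl hjw⟩

theorem exists_forall_abs_prod_le (hf : GeneralPosition f M) {i : ι} {B ε : ℝ} (hε : 0 ≤ ε)
    (hε1 : ε ≤ 1) {m : ℕ} (hcard : Fintype.card ι ≤ m + 1)
    (hdir : ∀ j, j ≠ i → ∃ w ∈ directions g (f i) B,
      f j w = 0 ∨ ∀ w' ∈ directions g (f i) B, |f j w'| ≤ ε) :
    ∃ w : Fin m → X, (∀ t, w t ∈ directions g (f i) B) ∧ ∀ j, j ≠ i → |∏ t, f j (w t)| ≤ ε := by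
  classical
  have := hf.nontrivial
  obtain ⟨k, hk⟩ := exists_ne i
  have : Nonempty {j // j ≠ i} := ⟨⟨k, hk⟩⟩
  obtain ⟨σ, hσ⟩ : ∃ σ : Fin m → {j // j ≠ i}, Function.Surjective σ := by
    have : Fintype.card {j // j ≠ i} ≤ Fintype.card (Fin m) := by
      rw [Fintype.card_subtype_compl, Fintype.card_subtype_eq, Fintype.card_fin]
      omega
    obtain ⟨e⟩ := Function.Embedding.nonempty_of_card_le this
    exact ⟨Function.invFun e, Function.invFun_surjective e.injective⟩
  choose! w hw hwj using hdir
  refine ⟨fun t => w (σ t), fun t => hw _ (σ t).2, fun j hj => ?_⟩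
  rcases hwj j hj with hj0 | hjε
  · obtain ⟨t, ht⟩ := hσ ⟨j, hj⟩
    rw [Finset.prod_eq_zero (Finset.mem_univ t) (show f j (w (σ t)) = 0 by rw [ht, hj0]), abs_zero]
    exact hε
  · have hm : m ≠ 0 := by have := hf.six_le_card; omega
    calc |∏ t, f j (w (σ t))| = ∏ t, |f j (w (σ t))| := Finset.abs_prod _ _
      _ ≤ ∏ _t : Fin m, ε := by gcongr with t; exact hjε _ (hw _ (σ t).2)
      _ = ε ^ m := by simp
      _ ≤ ε := pow_le_of_le_one hε hε1 hm

theorem exists_le_abs_sum_mul_prod (hf : GeneralPosition f M) (hg : ‖g‖ = 1) {m : ℕ}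
    (hcard : Fintype.card ι ≤ m + 1) (hmM : (m : ℝ) + 1 ≤ M) {v : X} (hv : ‖v‖ = 1) :
    ∃ w : Fin m → X, (∀ t, g (w t) = 0 ∧ ‖w t‖ ≤ M ^ 9) ∧
      1 / (2 * M) ≤ |∑ j, f j v * ∏ t, f j (w t)| := by
  classical
  have hM := hf.six_le
  obtain ⟨i, hiv, B, hB, hdir⟩ := hf.exists_directions hg v
  have hε1 : 1 / (2 * M ^ 2) ≤ 1 := by
    rw [div_le_one (by positivity)]
    nlinarith
  obtain ⟨w, hw, hprod⟩ := hf.exists_forall_abs_prod_le (by positivity) hε1 hcard hdir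
  refine ⟨w, fun t => ⟨(hw t).1, (hw t).2.2.trans hB⟩, ?_⟩
  have main_term : f i v * ∏ t, f i (w t) = f i v := by
    rw [Finset.prod_eq_one fun t _ => (hw t).2.1, mul_one]
  have main_term_ge : 1 / M ≤ |f i v| := by
    rwa [div_le_iff₀' (by linarith), ← hv]
  have other_terms_le : |∑ j ∈ Finset.univ.erase i, f j v * ∏ t, f j (w t)| ≤ 1 / (2 * M) := by
    calc |∑ j ∈ Finset.univ.erase i, f j v * ∏ t, f j (w t)|
        ≤ ∑ j ∈ Finset.univ.erase i, |f j v| * |∏ t, f j (w t)| := by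
          simpa only [abs_mul] using Finset.abs_sum_le_sum_abs (fun j => f j v * ∏ t, f j (w t)) _
      _ ≤ ∑ _j ∈ Finset.univ.erase i, 1 * (1 / (2 * M ^ 2)) := by
          gcongr with j hj
          · exact (hf.abs_le j v).trans hv.le
          · exact hprod j (Finset.ne_of_mem_erase hj)
      _ ≤ M * (1 * (1 / (2 * M ^ 2))) := by
          rw [Finset.sum_const, nsmul_eq_mul]
          gcongr
          refine le_trans ?_ hmM
          exact_mod_cast (Finset.card_le_univ _).trans hcard
      _ = 1 / (2 * M) := by field_simp
  rw [← Finset.add_sum_erase _ _ (Finset.mem_univ i), main_term]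
  calc 1 / (2 * M) = 1 / M - 1 / (2 * M) := by field_simp; norm_num
    _ ≤ |f i v| - |∑ j ∈ Finset.univ.erase i, f j v * ∏ t, f j (w t)| :=
      sub_le_sub main_term_ge other_terms_le
    _ ≤ _ := abs_sub_abs_le_abs_add _ _

-- Up to the factor `m + 1`, the sum is the derivative of `∑ i, f i ^ (m + 1)` at `y` along `v`.
theorem exists_le_abs_sum_mul_pow (hf : GeneralPosition f M) (hg : ‖g‖ = 1) {m : ℕ}
    (hcard : Fintype.card ι ≤ m + 1) (hmM : (m : ℝ) + 1 ≤ M) {v : X} (hv : ‖v‖ = 1) :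
    ∃ y, g y = 0 ∧ ‖y‖ ≤ M ^ 10 ∧ 1 / M ^ (m + 2) ≤ |∑ i, f i v * f i y ^ m| := by
  have hM := hf.six_le
  obtain ⟨w, hw, hprod⟩ := hf.exists_le_abs_sum_mul_prod hg hcard hmM hv
  obtain ⟨S, hS⟩ := exists_factorial_mul_abs_sum_mul_prod_le (fun i => f i v) f w
  rw [Fintype.card_fin] at hS
  refine ⟨∑ t ∈ S, w t, by simp [hw], ?_, ?_⟩
  · calc ‖∑ t ∈ S, w t‖ ≤ ∑ _t ∈ S, M ^ 9 := norm_sum_le_of_le _ fun t _ => (hw t).2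
      _ ≤ M * M ^ 9 := by
        rw [Finset.sum_const, nsmul_eq_mul]
        gcongr
        have : (S.card : ℝ) ≤ m := by exact_mod_cast card_finset_fin_le S
        linarith
      _ = M ^ 10 := by ring
  · set G := |∑ i, f i v * f i (∑ t ∈ S, w t) ^ m|
    have one_le_factorial : (1 : ℝ) ≤ m.factorial := by exact_mod_cast m.factorial_pos
    have lower : 1 / (2 * M) ≤ 2 ^ m * G :=
      (hprod.trans (le_mul_of_one_le_left (abs_nonneg _) one_le_factorial)).trans hS
    calc 1 / M ^ (m + 2) = 1 / (M ^ m * (M * M)) := by rw [pow_add, sq]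
      _ ≤ 1 / (2 ^ m * (2 * M)) := by gcongr <;> linarith
      _ ≤ G := by
        rw [div_le_iff₀ (by positivity)] at lower ⊢
        linarith

theorem exists_norm_add_smul_pow_le (hf : GeneralPosition f M) {m : ℕ}
    (hcard : Fintype.card ι ≤ m + 1) (hmM : (m : ℝ) + 1 ≤ M)
    (hnorm : ∀ x, ‖x‖ ^ (m + 1) = ∑ i, f i x ^ (m + 1)) {v y : X} (hv : ‖v‖ ≤ 1)
    (hy : ‖y‖ ≤ M ^ 10) (hvy : 1 / M ^ (m + 2) ≤ |∑ i, f i v * f i y ^ m|) :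
    ∃ t : ℝ, ‖y + t • v‖ ^ (m + 1) ≤ ‖y‖ ^ (m + 1) - 1 / M ^ (13 * m + 16) := by
  have hM := hf.six_le
  set G := ∑ i, f i v * f i y ^ m
  set τ := 1 / M ^ (12 * m + 14) with hτ
  have hτ0 : 0 ≤ τ := by positivity
  obtain ⟨t, ht, htG⟩ := exists_abs_eq_and_mul_eq_neg G hτ0
  have hτ1 : |t| ≤ 1 := by
    rw [ht, hτ, div_le_one (by positivity)]
    exact one_le_pow₀ (by linarith)
  have first_order : (m + 1) * t * G ≤ -(2 * (τ * (1 / M ^ (m + 2)))) := by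
    have two_le : (2 : ℝ) ≤ m + 1 := by
      exact_mod_cast (by have := hf.six_le_card; omega : 2 ≤ m + 1)
    rw [mul_assoc, htG, mul_neg]
    gcongr
  have second_order : Fintype.card ι * t ^ 2 * (‖y‖ + 1) ^ (m + 1) ≤ τ * (1 / M ^ (m + 2)) := by
    have base_le : ‖y‖ + 1 ≤ M ^ 11 := by
      have : 1 ≤ M ^ 10 := one_le_pow₀ (by linarith)
      rw [pow_succ]
      nlinarith
    calc Fintype.card ι * t ^ 2 * (‖y‖ + 1) ^ (m + 1)
        ≤ M * τ ^ 2 * (M ^ 11) ^ (m + 1) := by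
          rw [← sq_abs, ht]
          gcongr
          exact le_trans (by exact_mod_cast hcard) hmM
      _ = τ * (1 / M ^ (m + 2)) := by
          rw [hτ]
          field_simp
          ring
  have decrease : τ * (1 / M ^ (m + 2)) = 1 / M ^ (13 * m + 16) := by
    rw [hτ]
    field_simp
    ring
  refine ⟨t, ?_⟩
  have := sum_apply_add_smul_pow_le hf.abs_le hv y hτ1 m
  rw [← hnorm, ← hnorm] at this
  linarith

theorem le_opNorm_projection (hf : GeneralPosition f M) {m : ℕ}
    (hcard : Fintype.card ι ≤ m + 1) (hmM : (m : ℝ) + 1 ≤ M)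
    (hnorm : ∀ x, ‖x‖ ^ (m + 1) = ∑ i, f i x ^ (m + 1)) {Y : Submodule ℝ X}
    (hY : Module.finrank ℝ Y + 1 = Module.finrank ℝ X) {P : X →L[ℝ] Y} (hP : P ∈ projections Y) :
    1 + 1 / M ^ (23 * m + 28) ≤ ‖P‖ := by
  have hM := hf.six_le
  have := hf.finiteDimensional
  obtain ⟨g, hg, hgY⟩ := exists_norm_eq_one_ker_eq hY
  obtain ⟨v, hv, hPv⟩ := exists_norm_eq_one_map_eq_zero P (by omega)
  obtain ⟨y, hgy, hy, hvy⟩ := hf.exists_le_abs_sum_mul_pow hg hcard hmM hv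
  obtain ⟨t, ht⟩ := hf.exists_norm_add_smul_pow_le hcard hmM hnorm hv.le hy hvy
  have hyY : y ∈ Y := hgY ▸ hgy
  set ε := 1 / M ^ (23 * m + 28) with hε
  by_contra! hPε
  have norm_y_le : ‖y‖ ≤ (1 + ε) * ‖y + t • v‖ :=
    (norm_le_opNorm_mul_norm_add_smul hP hPv hyY t).trans (by gcongr)
  have hε1 : ε ≤ 1 := by
    rw [hε, div_le_one (by positivity)]
    exact one_le_pow₀ (by linarith)
  have : 1 / M ^ (13 * m + 16) ≤ 1 / M ^ (13 * m + 17) := by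
    calc 1 / M ^ (13 * m + 16) ≤ ‖y‖ ^ (m + 1) - ‖y + t • v‖ ^ (m + 1) := by linarith
      _ ≤ ((m + 1 : ℕ) : ℝ) * ε * ‖y‖ ^ (m + 1) :=
        pow_sub_pow_le_of_le_one_add_mul (norm_nonneg _) (norm_nonneg _) hε1 norm_y_le _
      _ ≤ M * ε * (M ^ 10) ^ (m + 1) := by
        gcongr
        exact_mod_cast hmM
      _ = 1 / M ^ (13 * m + 17) := by
        rw [hε]
        field_simp
        ring
  refine this.not_gt ?_
  gcongr <;> [linarith; omega]

theorem le_relProjConst (hf : GeneralPosition f M) {m : ℕ} (hcard : Fintype.card ι ≤ m + 1)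
    (hmM : (m : ℝ) + 1 ≤ M) (hnorm : ∀ x, ‖x‖ ^ (m + 1) = ∑ i, f i x ^ (m + 1))
    {Y : Submodule ℝ X} (hY : Module.finrank ℝ Y + 1 = Module.finrank ℝ X) :
    1 + 1 / M ^ (23 * m + 28) ≤ relProjConst Y := by
  have := hf.finiteDimensional
  refine le_csInf ((projections_nonempty Y).image _) ?_
  rintro _ ⟨P, hP, rfl⟩
  exact hf.le_opNorm_projection hcard hmM hnorm hY hP

end GeneralPosition

/-! ### The explicit forms -/

/-- The coefficients of `f k` in the two relations `f₁ + ⋯ + fₙ - fₙ₊₁ = 0` and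
`f₁ + 2 f₂ + ⋯ + n fₙ - n fₙ₊₂ = 0` between the `functionals n`. -/
def relationColumn (n : ℕ) (k : Fin (n + 2)) : ℤ × ℤ :=
  if (k : ℕ) < n then (1, (k : ℤ) + 1) else if (k : ℕ) = n then (-1, 0) else (0, -(n : ℤ))

/-- The `2 × 2` minors of the matrix of relations. Their being nonzero makes every `n` of the
`functionals n` independent, and their size bounds the dual bases. -/
def relationMinor (n : ℕ) (i j : Fin (n + 2)) : ℤ :=
  (relationColumn n i).1 * (relationColumn n j).2 - (relationColumn n j).1 * (relationColumn n i).2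

theorem relationMinor_ne_zero {n : ℕ} (hn : n ≠ 0) {i j : Fin (n + 2)} (hij : i ≠ j) :
    relationMinor n i j ≠ 0 := by
  have := Fin.val_ne_of_ne hij
  simp only [relationMinor, relationColumn]
  split_ifs <;> omega

theorem abs_relationMinor_le (n : ℕ) (i j : Fin (n + 2)) : |relationMinor n i j| ≤ n := by
  simp only [relationMinor, relationColumn, abs_le]
  split_ifs <;> omega

theorem functionals_castAdd (n : ℕ) (i : Fin n) (x : Fin n → ℝ) :
    functionals n (Fin.castAdd 2 i) x = x i := by
  simp [functionals]

theorem functionals_natAdd_zero (n : ℕ) (x : Fin n → ℝ) :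
    functionals n (Fin.natAdd n 0) x = ∑ j, x j := by
  simp [functionals]

theorem functionals_natAdd_one (n : ℕ) (x : Fin n → ℝ) :
    functionals n (Fin.natAdd n 1) x = (n : ℝ)⁻¹ * ∑ j : Fin n, ((j : ℝ) + 1) * x j := by
  simp [functionals]

theorem pi_functionals_injective (n : ℕ) :
    Function.Injective (LinearMap.pi (functionals n)) := by
  intro x y hxy
  ext j
  simpa only [LinearMap.pi_apply, functionals_castAdd] using congrFun hxy (Fin.castAdd 2 j)

theorem exists_functionals_eq_iff {n : ℕ} (hn : n ≠ 0) {z : Fin (n + 2) → ℝ} :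
    (∃ x, ∀ k, functionals n k x = z k) ↔
      ∑ k, (relationColumn n k).1 * z k = 0 ∧ ∑ k, (relationColumn n k).2 * z k = 0 := by
  have hn' : (n : ℝ) ≠ 0 := Nat.cast_ne_zero.2 hn
  simp only [relationColumn, Fin.sum_univ_add, Fin.sum_univ_two, Fin.val_castAdd, Fin.is_lt,
    Fin.val_natAdd, Fin.val_zero, Fin.val_one, add_lt_iff_neg_left, not_lt_zero, Nat.add_eq_left,
    one_ne_zero, ↓reduceIte]
  push_cast
  constructor
  · rintro ⟨x, hx⟩
    simp only [← hx, functionals_castAdd, functionals_natAdd_zero, functionals_natAdd_one]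
    exact ⟨by simp, by field_simp; ring⟩
  · rintro ⟨sum_eq, weighted_sum_eq⟩
    refine ⟨fun j => z (Fin.castAdd 2 j),
      Fin.addCases (fun k => ?_) (Fin.forall_fin_two.2 ⟨?_, ?_⟩)⟩
    · rw [functionals_castAdd]
    · rw [functionals_natAdd_zero]
      simp only [one_mul] at sum_eq
      linarith
    · rw [functionals_natAdd_one, inv_mul_eq_iff_eq_mul₀ hn']
      linarith

theorem exists_functionals_dual {n : ℕ} (hn : n ≠ 0) {i a b : Fin (n + 2)} (hia : i ≠ a)
    (hib : i ≠ b) (hab : a ≠ b) : ∃ x, functionals n i x = 1 ∧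
      (∀ j, j ≠ i → j ≠ a → j ≠ b → functionals n j x = 0) ∧
      ∑ j, |functionals n j x| ≤ 2 * n + 1 := by
  have minor_ne : (relationMinor n a b : ℝ) ≠ 0 :=
    Int.cast_ne_zero.2 (relationMinor_ne_zero hn hab)
  have abs_div_le : ∀ j k, |(relationMinor n j k : ℝ) / relationMinor n a b| ≤ n := by
    intro j k
    rw [abs_div]
    refine (div_le_self (abs_nonneg _) ?_).trans (by exact_mod_cast abs_relationMinor_le n j k)
    exact_mod_cast Int.one_le_abs (relationMinor_ne_zero hn hab)
  set α : ℝ := relationMinor n b i / relationMinor n a b with hα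
  set β : ℝ := relationMinor n i a / relationMinor n a b with hβ
  set z : Fin (n + 2) → ℝ := Pi.single i 1 + Pi.single a α + Pi.single b β with hz
  have sum_mul_z : ∀ c : Fin (n + 2) → ℝ, ∑ k, c k * z k = c i + c a * α + c b * β := by
    intro c
    simp [hz, mul_add, Finset.sum_add_distrib, Pi.single_apply]
  -- `α` and `β` come from Cramer's rule.
  obtain ⟨x, hx⟩ : ∃ x, ∀ k, functionals n k x = z k := by
    rw [exists_functionals_eq_iff hn, sum_mul_z, sum_mul_z, hα, hβ]
    constructor <;> field_simp <;> simp only [relationMinor] <;> push_cast <;> ring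
  refine ⟨x, by simp [hx, hz, hia, hib], fun j hji hja hjb => by simp [hx, hz, hji, hja, hjb], ?_⟩
  calc ∑ j, |functionals n j x|
      ≤ ∑ j, (Pi.single i 1 j + Pi.single a |α| j + Pi.single b |β| j) := by
        refine Finset.sum_le_sum fun j _ => ?_
        rw [hx, hz]
        refine (abs_add_three _ _ _).trans_eq ?_
        simp only [Pi.single_apply, apply_ite abs, abs_one, abs_zero]
    _ = 1 + |α| + |β| := by simp [Finset.sum_add_distrib]
    _ ≤ 2 * n + 1 := by linarith [abs_div_le b i, abs_div_le i a]

theorem functionals_apply_eq_zero {n : ℕ} (hn : n ≠ 0) {a b : Fin (n + 2)} (hab : a ≠ b)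
    {x : Fin n → ℝ} (hx : ∀ j, j ≠ a → j ≠ b → functionals n j x = 0) :
    functionals n a x = 0 := by
  obtain ⟨h₁, h₂⟩ := (exists_functionals_eq_iff hn).1 ⟨x, fun _ => rfl⟩
  have sum_eq : ∀ c : Fin (n + 2) → ℝ, ∑ k, c k * functionals n k x =
      c a * functionals n a x + c b * functionals n b x := fun c =>
    Fintype.sum_eq_add a b hab fun k hk => by rw [hx k hk.1 hk.2, mul_zero]
  rw [sum_eq] at h₁ h₂
  have minor_mul : (relationMinor n a b : ℝ) * functionals n a x = 0 := by
    rw [relationMinor]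
    push_cast
    linear_combination ((relationColumn n b).2 : ℝ) * h₁ - ((relationColumn n b).1 : ℝ) * h₂
  exact (mul_eq_zero.1 minor_mul).resolve_left
    (Int.cast_ne_zero.2 (relationMinor_ne_zero hn hab))

theorem eq_zero_of_functionals_eq_zero {n : ℕ} (hn : n ≠ 0) {a b : Fin (n + 2)} (hab : a ≠ b)
    {x : Fin n → ℝ} (hx : ∀ j, j ≠ a → j ≠ b → functionals n j x = 0) : x = 0 := by
  refine (map_eq_zero_iff _ (pi_functionals_injective n)).1 (funext fun j => ?_)
  rcases eq_or_ne j a with rfl | hja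
  · exact functionals_apply_eq_zero hn hab hx
  rcases eq_or_ne j b with rfl | hjb
  · exact functionals_apply_eq_zero hn hab.symm fun k hkj hka => hx k hka hkj
  · exact hx j hja hjb

theorem halfExponent_bounds (n : ℕ) : n + 2 ≤ 2 * halfExponent n ∧ 2 * halfExponent n ≤ n + 3 := by
  constructor
  · have : ((n : ℝ) + 2) / 2 ≤ halfExponent n := Nat.le_ceil _
    exact_mod_cast (by linarith : (n : ℝ) + 2 ≤ 2 * halfExponent n)
  · have : (halfExponent n : ℝ) < ((n : ℝ) + 2) / 2 + 1 := Nat.ceil_lt_add_one (by positivity)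
    have : 2 * halfExponent n < n + 4 := by
      exact_mod_cast (by linarith : 2 * (halfExponent n : ℝ) < n + 4)
    omega

theorem explicitNorm_pow (n : ℕ) (x : Fin n → ℝ) :
    explicitNorm n x ^ (2 * halfExponent n) = ∑ i, functionals n i x ^ (2 * halfExponent n) := by
  have hp : (halfExponent n : ℝ) ≠ 0 := by
    have := (halfExponent_bounds n).1
    exact Nat.cast_ne_zero.2 (by omega)
  rw [explicitNorm, ← Real.rpow_natCast, ← Real.rpow_mul (by positivity)]
  push_cast
  rw [one_div_mul_cancel (by simpa using hp), Real.rpow_one]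
  simp_rw [(even_two_mul _).pow_abs]

theorem exists_normedSpace_explicitNorm (n : ℕ) :
    ∃ (X : Type) (_ : NormedAddCommGroup X) (_ : NormedSpace ℝ X) (e : X ≃ₗ[ℝ] (Fin n → ℝ)),
      ∀ x : X, ‖x‖ = explicitNorm n (e x) := by
  have hp := (halfExponent_bounds n).1
  have : Fact (1 ≤ ((2 * halfExponent n : ℕ) : ENNReal)) :=
    ⟨by exact_mod_cast (by omega : 1 ≤ 2 * halfExponent n)⟩
  let T : (Fin n → ℝ) →ₗ[ℝ] PiLp ((2 * halfExponent n : ℕ) : ENNReal) (fun _ : Fin (n + 2) => ℝ) :=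
    (WithLp.linearEquiv _ ℝ (Fin (n + 2) → ℝ)).symm.toLinearMap ∘ₗ LinearMap.pi (functionals n)
  have hT : Function.Injective T :=
    (WithLp.linearEquiv _ ℝ _).symm.injective.comp (pi_functionals_injective n)
  refine ⟨LinearMap.range T, inferInstance, inferInstance,
    (LinearEquiv.ofInjective T hT).symm, fun x => ?_⟩
  obtain ⟨y, rfl⟩ := (LinearEquiv.ofInjective T hT).surjective x
  have apply_T : ∀ i, T y i = functionals n i y := fun _ => rfl
  have hp0 : 0 < (2 * halfExponent n : ℝ) := by exact_mod_cast (by omega : 0 < 2 * halfExponent n)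
  rw [LinearEquiv.symm_apply_apply, Submodule.coe_norm, LinearEquiv.ofInjective_apply,
    PiLp.norm_eq_sum (by simpa using hp0), explicitNorm]
  simp only [ENNReal.toReal_natCast, Real.rpow_natCast, apply_T, Real.norm_eq_abs]
  push_cast
  rfl

theorem generalPosition_functionals {n : ℕ} (hn : 4 ≤ n) {X : Type*} [NormedAddCommGroup X]
    [NormedSpace ℝ X] (e : X ≃ₗ[ℝ] (Fin n → ℝ)) (he : ∀ x, ‖x‖ = explicitNorm n (e x)) :
    GeneralPosition (fun i => functionals n i ∘ₗ e.toLinearMap) (2 * ((n : ℝ) + 3) ^ 2) := by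
  have hn0 : n ≠ 0 := by omega
  have hp : 2 * halfExponent n ≠ 0 := by have := (halfExponent_bounds n).1; omega
  have norm_pow : ∀ x, ‖x‖ ^ (2 * halfExponent n) =
      ∑ i, functionals n i (e x) ^ (2 * halfExponent n) := fun x => by rw [he, explicitNorm_pow]
  refine ⟨by rw [Fintype.card_fin]; omega, fun i x => ?_, fun i a b hia hib hab => ?_,
    fun a b x hab hx => e.map_eq_zero_iff.1 (eq_zero_of_functionals_eq_zero hn0 hab hx)⟩
  · exact abs_le_of_pow_eq_sum (even_two_mul _) hp (norm_nonneg x) (norm_pow x) i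
  · obtain ⟨x, hix, hjx, hx⟩ := exists_functionals_dual hn0 hia hib hab
    refine ⟨e.symm x, by simpa using hix, by simpa using hjx, ?_⟩
    have norm_le : ‖e.symm x‖ ≤ 2 * n + 1 := by
      refine le_trans ?_ hx
      simpa using le_sum_abs_of_pow_eq_sum (even_two_mul _) hp (norm_pow (e.symm x))
    rw [Fintype.card_fin]
    push_cast
    nlinarith [norm_nonneg (e.symm x)]

theorem corollary1p2 (n : ℕ) (hn : 4 ≤ n) :
    ∃ (X : Type) (_ : NormedAddCommGroup X) (_ : NormedSpace ℝ X),
      Module.finrank ℝ X = n ∧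
      (∃ e : X ≃ₗ[ℝ] (Fin n → ℝ), ∀ x : X, ‖x‖ = explicitNorm n (e x)) ∧
      ∀ Y : Submodule ℝ X, Module.finrank ℝ Y = n - 1 →
        relProjConst Y >
          1 + (2 * ((n : ℝ) + 3) ^ 2) ^ (-(100 * ((n : ℤ) + 3) ^ 2)) := by
  obtain ⟨X, _, _, e, he⟩ := exists_normedSpace_explicitNorm n
  have finrank_eq : Module.finrank ℝ X = n := by rw [e.finrank_eq, Module.finrank_fin_fun]
  refine ⟨X, inferInstance, inferInstance, finrank_eq, ⟨e, he⟩, fun Y hY => ?_⟩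
  obtain ⟨m, hm⟩ : ∃ m, m + 1 = 2 * halfExponent n :=
    ⟨2 * halfExponent n - 1, by have := (halfExponent_bounds n).1; omega⟩
  obtain ⟨le_m, m_le⟩ := halfExponent_bounds n
  rw [← hm] at le_m m_le
  have m_le' : (m : ℝ) + 1 ≤ n + 3 := by exact_mod_cast m_le
  have lower_bound : 1 + 1 / (2 * ((n : ℝ) + 3) ^ 2) ^ (23 * m + 28) ≤ relProjConst Y :=
    (generalPosition_functionals hn e he).le_relProjConst (by simpa using le_m) (by nlinarith)
      (fun x => by rw [hm, he, explicitNorm_pow]; rfl) (by omega)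
  refine lt_of_lt_of_le ?_ lower_bound
  have exponent_lt : 23 * m + 28 < 100 * (n + 3) ^ 2 := by
    linarith [Nat.le_self_pow two_ne_zero (n + 3)]
  rw [show -(100 * ((n : ℤ) + 3) ^ 2) = -((100 * (n + 3) ^ 2 : ℕ) : ℤ) by push_cast; ring,
    zpow_neg, zpow_natCast, ← one_div]
  gcongr
  nlinarith
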